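/- Let $N\ge 0$ be an integer, let $0<\zeta_1<\dots<\zeta_{\lfloor N/2\rfloor}$ and $b_1,\dots,b_{\lfloor N/2\rfloor}>0$, and let $c>0$ if $N$ is odd and $c=0$ if $N$ is even. Put $\mu=\sum_{j=1}^{\lfloor N/2\rfloor} b_j\,\delta_{\zeta_j}$ and $$W(z)=c+\int\frac{d\mu(x)}{x-z}=c+\sum_{j=1}^{\lfloor N/2\rfloor}\frac{b_j}{\zeta_j-z}.$$ Let $m_1,\dots,m_N,n_1,\dots,n_N>0$ be such that the products $m_jn_j$ are pairwise distinct. Inverse problem: find positive numbers $g_j,h_j$, $1\le j\le N$, such that $g_jh_j=m_jn_j$ for all $j$ and such that the polynomials $q_k(z),p_k(z)$ defined by $$\begin{bmatrix} q_0\\ p_0\end{bmatrix}=\begin{bmatrix}0\\1\end{bmatrix},\qquad \begin{bmatrix} q_k\\ p_k\end{bmatrix}=\begin{bmatrix}1&h_k\\-zg_k&1\end{bmatrix}\begin{bmatrix} q_{k-1}\\ p_{k-1}\end{bmatrix},\quad 1\le k\le N,$$ satisfy $q_N(z)/p_N(z)=W(z)$ as rational functions. Notation: write $i'=N+1-i$,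 $e_i=\dfrac1{m_{i'}n_{i'}}$ for $1\le i\le N$, $\mathbf e_{[1,k]}=e_1e_2\cdots e_k$ (equal to $1$ for $k=0$), and $\hat\mu_c(y)=c+\int\frac{d\mu(x)}{y+x}$. For $0\le k\le N$, $0\le l\le k$ and $p\ge0$ let $CSV_k^{(l,p)}$ be the $k\times k$ Cauchy–Stieltjes–Vandermonde matrix whose $i$-th row is $$\big(e_i^{p}\hat\mu_c(e_i),\ e_i^{p+1}\hat\mu_c(e_i),\ \dots,\ e_i^{p+l-1}\hat\mu_c(e_i),\ 1,\ e_i,\ \dots,\ e_i^{k-l-1}\big),$$ and let $\mathcal D_k^{(l,p)}=\big|\det CSV_k^{(l,p)}\big|$, with $\mathcal D_0^{(l,p)}=1$. Theorem. The inverse problem has exactly one solution. It is given, for $1\le k\le N$, by $$g_{k'}=\frac{\mathcal D_k^{(\frac{k-1}2,1)}\,\mathcal D_{k-1}^{(\frac{k-1}2,1)}}{\mathbf e_{[1,k]}\,\mathcal D_k^{(\frac{k+1}2,0)}\,\mathcal D_{k-1}^{(\frac{k-1}2,0)}},\qquad h_{k'}=\frac{\mathbf e_{[1,k-1]}\,\mathcal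 D_k^{(\frac{k+1}2,0)}\,\mathcal D_{k-1}^{(\frac{k-1}2,0)}}{\mathcal D_k^{(\frac{k-1}2,1)}\,\mathcal D_{k-1}^{(\frac{k-1}2,1)}}\qquad\text{if } k \text{ is odd},$$ $$g_{k'}=\frac{\mathcal D_k^{(\frac k2,1)}\,\mathcal D_{k-1}^{(\frac k2-1,1)}}{\mathbf e_{[1,k]}\,\mathcal D_k^{(\frac k2,0)}\,\mathcal D_{k-1}^{(\frac k2,0)}},\qquad h_{k'}=\frac{\mathbf e_{[1,k-1]}\,\mathcal D_k^{(\frac k2,0)}\,\mathcal D_{k-1}^{(\frac k2,0)}}{\mathcal D_k^{(\frac k2,1)}\,\mathcal D_{k-1}^{(\frac k2-1,1)}}\qquad\text{if } k \text{ is even}.$$ -/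

import Mathlib

open Polynomial MeasureTheory

noncomputable section

/-- The transition matrix `T(z) = [[1, h], [-z g, 1]]`, with entries polynomials in `z`. -/
def transferMatrix (g h : ℝ) : Matrix (Fin 2) (Fin 2) ℝ[X] :=
  !![1, C h; -(X * C g), 1]

/-- The solution `(q_k, p_k)`, `k = 0, …, N`, of the initial value problem
`(q_k, p_k)ᵀ = T_k(z) (q_{k-1}, p_{k-1})ᵀ`, `(q_0, p_0) = (0, 1)`.
The entry `i : Fin N` of `g` and of `h` is the quantity with index `i + 1` in `1, …, N`. -/
def rodSolution {N : ℕ} (g h : Fin N → ℝ) (k : Fin (N + 1)) : Fin 2 → ℝ[X] :=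
  Fin.induction (motive := fun _ => Fin 2 → ℝ[X]) ![0, 1]
    (fun i v => (transferMatrix (g i) (h i)).mulVec v) k

/-- The discrete measure `μ = ∑ j, b_j δ_{ζ_j}`. -/
def spectralMeasure {K : ℕ} (ζ b : Fin K → ℝ) : Measure ℝ :=
  ∑ j, ENNReal.ofReal (b j) • Measure.dirac (ζ j)

/-- The rational function `W(z) = c + ∫ dμ(x) / (x - z) = c + ∑ j, b_j / (ζ_j - z)`. -/
def weylFunction {K : ℕ} (ζ b : Fin K → ℝ) (c : ℝ) : RatFunc ℝ :=
  RatFunc.C c + ∑ j, RatFunc.C (b j) / (RatFunc.C (ζ j) - RatFunc.X)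

/-- `(g, h)` solves the inverse problem with data `W` and masses `m`, `n`: all `g_j`, `h_j` are
positive, `g_j h_j = m_j n_j`, and `q_N / p_N = W` as rational functions. (The polynomial `p_N`
is never zero, since `p_N(0) = 1`.) -/
def SolvesInverseProblem {N : ℕ} (W : RatFunc ℝ) (m n : Fin N → ℝ) (g h : Fin N → ℝ) : Prop :=
  (∀ j, 0 < g j) ∧ (∀ j, 0 < h j) ∧ (∀ j, g j * h j = m j * n j) ∧
    algebraMap ℝ[X] (RatFunc ℝ) (rodSolution g h (Fin.last N) 0) /
      algebraMap ℝ[X] (RatFunc ℝ) (rodSolution g h (Fin.last N) 1) = W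

/-- The shifted Stieltjes transform `c + ∫ dν(x) / (y + x)`. -/
def shiftedStieltjes (ν : Measure ℝ) (c y : ℝ) : ℝ :=
  c + ∫ x, 1 / (y + x) ∂ν

/-- The `k × k` Cauchy-Stieltjes-Vandermonde matrix: row `i` is
`e_i^p ν̂_c(e_i), …, e_i^(p+l-1) ν̂_c(e_i), 1, e_i, …, e_i^(k-l-1)`. It is used for `l ≤ k` only,
and then the first group has `l` columns and the second one `k - l` columns. -/
def csvMatrix {k : ℕ} (l p : ℕ) (e : Fin k → ℝ) (ν : Measure ℝ) (c : ℝ) :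
    Matrix (Fin k) (Fin k) ℝ :=
  Matrix.of fun i j =>
    if (j : ℕ) < l then e i ^ (p + (j : ℕ)) * shiftedStieltjes ν c (e i)
    else e i ^ ((j : ℕ) - l)

/-- The numbers `e_1, …, e_k`, where `e_i = 1 / (m_{i'} n_{i'})` and `i' = N + 1 - i`. -/
def nodes {N : ℕ} (m n : Fin N → ℝ) (k : ℕ) (hk : k ≤ N) (i : Fin k) : ℝ :=
  1 / (m (Fin.castLE hk i).rev * n (Fin.castLE hk i).rev)

/-- `𝒟_k^{(l,p)} = |det CSV_k^{(l,p)}(e, μ, c)|`; for `k = 0` this is `1`. -/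
def csvDet {N : ℕ} (m n : Fin N → ℝ) (μ : Measure ℝ) (c : ℝ)
    (k : ℕ) (hk : k ≤ N) (l p : ℕ) : ℝ :=
  |(csvMatrix l p (nodes m n k hk) μ c).det|

/-- The product `e_{[1,k]} = e_1 e_2 ⋯ e_k`. -/
def nodesProd {N : ℕ} (m n : Fin N → ℝ) (k : ℕ) (hk : k ≤ N) : ℝ :=
  ∏ i, nodes m n k hk i

end

/-! Put y = -z. A layer has determinant 1 - y g h, so it is singular exactly at its own node y =
1/(m_j n_j). Multiplying by adjugates from the outermost layer inwards gives polynomials A, B with A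
q_N + B p_N = ∏ (1 - y g h) q_{N-k}, the product taken over the k outermost layers. Hence A W + B
vanishes at e_1, …, e_k. With A(0) = 1 and the degree bounds this is a k × k linear system whose
matrix is a CSV matrix. It is invertible because the homogeneous problem can be peeled layer by
layer (`eq_zero_of_interpolates_zero`). The top coefficient of (A, B) is, up to sign, an alternating
product of h's and g's, and Cramer's rule makes it a quotient of two CSV determinants
(`abs_strippingLead_mul_abs_det`). Comparing k with k - 1 isolates g and h, which gives the formulas
and with them uniqueness.

Existence is an induction on N (`exists_rod`). Singularity forces h_N = W(-e_1). Removing that layer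
turns W into a positive multiple of S/F, where S = ∑ β_j/(ζ_j + y), F = c + ∑ ζ_j β_j/(ζ_j + y) and
β_j = b_j/(ζ_j + e_1). The zeros of F interlace its poles and the residues of S/F are positive, so
S/F is again of Weyl form, with the parity switched. -/

noncomputable section

/-! ### Unisolvence of the interpolation problem. -/

/-- Removing a linear factor lowers the degree bound by one. -/
theorem degree_lt_of_degree_X_sub_C_mul_lt {a : ℝ} {f : ℝ[X]} {n : ℕ}
    (h : ((X - C a) * f).degree < ((n + 1 : ℕ) : WithBot ℕ)) : f.degree < (n : WithBot ℕ) := by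
  by_cases hf : f = 0
  · subst hf
    rw [degree_zero]
    exact WithBot.bot_lt_coe n
  · rw [degree_mul, degree_X_sub_C, degree_eq_natDegree hf] at h
    rw [degree_eq_natDegree hf]
    norm_cast at h ⊢
    omega

theorem degree_C_mul_le_degree (a : ℝ) (f : ℝ[X]) : (C a * f).degree ≤ f.degree := by
  rw [← smul_eq_C_mul]; exact degree_smul_le a f

/-- Unisolvence of the mixed interpolation problem for `q 0 / p 0` at the nodes `E 0, …, E (k-1)`,
where the pairs `(q j, p j)` are connected by the transfer recurrence. -/
theorem eq_zero_of_interpolates_zero (k : ℕ) : ∀ (E G H : ℕ → ℝ) (q p : ℕ → ℝ → ℝ),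
    (∀ j < k, 0 < E j) → Set.InjOn E (Set.Iio k) → (∀ j < k, G j * H j * E j = 1) →
    (∀ j < k, ∀ y, q j y = q (j + 1) y + H j * p (j + 1) y) →
    (∀ j < k, ∀ y, p j y = y * G j * q (j + 1) y + p (j + 1) y) →
    (∀ j < k, ∀ y, 0 < y → p j y ≠ 0) →
    ∀ A B : ℝ[X], A.eval 0 = 0 → A.degree < (((k + 2) / 2 : ℕ) : WithBot ℕ) →
    B.degree < (((k + 1) / 2 : ℕ) : WithBot ℕ) →
    (∀ i < k, A.eval (E i) * q 0 (E i) + B.eval (E i) * p 0 (E i) = 0) → A = 0 ∧ B = 0 := by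
  induction k with
  | zero =>
    intro E G H q p _ _ _ _ _ _ A B hA0 hA hB _
    refine ⟨?_, ?_⟩
    · have h := eq_C_of_degree_le_zero (Nat.WithBot.lt_one_iff_le_zero.mp (by simpa using hA))
      rw [h] at hA0 ⊢
      simpa using hA0
    · simpa [Nat.WithBot.lt_zero_iff] using hB
  | succ k ih =>
    intro E G H q p hE hinj hGH hq hp hpos A B hA0 hA hB hint
    have h0 : 0 < k + 1 := Nat.succ_pos k
    have hH0 : H 0 ≠ 0 := by
      intro h
      have := hGH 0 h0
      simp [h] at this
    -- At y = E 0 the layer is singular with image spanned by (H 0, 1).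
    have hqp : q 0 (E 0) = H 0 * p 0 (E 0) := by
      rw [hq 0 h0, hp 0 h0]
      linear_combination (-q 1 (E 0)) * hGH 0 h0
    have hB'r : H 0 * A.eval (E 0) + B.eval (E 0) = 0 := by
      have h1 := hint 0 h0
      rw [hqp] at h1
      refine (mul_eq_zero.mp ?_).resolve_right (hpos 0 h0 _ (hE 0 h0))
      linear_combination h1
    have hA'r : A.eval (E 0) + G 0 * E 0 * B.eval (E 0) = 0 := by
      refine (mul_eq_zero.mp ?_).resolve_left hH0
      linear_combination hB'r + B.eval (E 0) * hGH 0 h0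
    -- The row (A, B) times the layer vanishes at E 0. Its quotient by X - E 0 solves the same
    -- problem for the remaining k nodes.
    obtain ⟨A₁, hA₁⟩ : X - C (E 0) ∣ A + C (G 0) * X * B := by
      rw [dvd_iff_isRoot, IsRoot.def]
      simpa using hA'r
    obtain ⟨B₁, hB₁⟩ : X - C (E 0) ∣ C (H 0) * A + B := by
      rw [dvd_iff_isRoot, IsRoot.def]
      simpa using hB'r
    have evA : ∀ y, A.eval y + G 0 * y * B.eval y = (y - E 0) * A₁.eval y := by
      intro y
      simpa using congrArg (eval y) hA₁
    have evB : ∀ y, H 0 * A.eval y + B.eval y = (y - E 0) * B₁.eval y := by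
      intro y
      simpa using congrArg (eval y) hB₁
    have key : A₁ = 0 ∧ B₁ = 0 := by
      refine ih (fun j => E (j + 1)) (fun j => G (j + 1)) (fun j => H (j + 1))
        (fun j => q (j + 1)) (fun j => p (j + 1)) (fun j hj => hE _ (by omega)) ?_
        (fun j hj => hGH _ (by omega)) (fun j hj => hq _ (by omega)) (fun j hj => hp _ (by omega))
        (fun j hj => hpos _ (by omega)) A₁ B₁ ?_ ?_ ?_ ?_
      · intro i hi j hj hij
        have := hinj (Set.mem_Iio.mpr (Nat.succ_lt_succ hi)) (Set.mem_Iio.mpr (Nat.succ_lt_succ hj)) hij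
        omega
      · have := evA 0
        rw [hA0] at this
        have hE0 := (hE 0 h0).ne'
        simpa [hE0] using this
      · apply degree_lt_of_degree_X_sub_C_mul_lt (a := E 0)
        rw [← hA₁]
        refine (degree_add_le _ _).trans_lt (max_lt (hA.trans_le (by exact_mod_cast (by omega))) ?_)
        rw [mul_assoc]
        refine (degree_C_mul_le_degree _ _).trans_lt ?_
        rw [degree_mul, degree_X, add_comm]
        have : (((k + 2) / 2 + 1 : ℕ) : WithBot ℕ) = (((k + 2) / 2 : ℕ) : WithBot ℕ) + 1 := by
          push_cast; rfl
        rw [this]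
        exact WithBot.add_lt_add_right (by simp) hB
      · apply degree_lt_of_degree_X_sub_C_mul_lt (a := E 0)
        rw [← hB₁]
        refine (degree_add_le _ _).trans_lt (max_lt ?_ (hB.trans_le (by exact_mod_cast (by omega))))
        exact (degree_C_mul_le_degree _ _).trans_lt (hA.trans_le (by exact_mod_cast (by omega)))
      · intro i hi
        have hne : E (i + 1) - E 0 ≠ 0 := by
          intro h
          have := hinj (Set.mem_Iio.mpr (Nat.succ_lt_succ hi)) (Set.mem_Iio.mpr h0)
            (sub_eq_zero.mp h)
          omega
        have h1 := hint (i + 1) (by omega)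
        rw [hq 0 h0, hp 0 h0] at h1
        refine (mul_eq_zero.mp ?_).resolve_left hne
        linear_combination h1 - q 1 (E (i + 1)) * evA (E (i + 1)) - p 1 (E (i + 1)) * evB (E (i + 1))
    rw [key.1, mul_zero] at hA₁
    rw [key.2, mul_zero] at hB₁
    -- Eliminating B leaves A times the determinant of the layer, a nonzero polynomial since its
    -- value at 0 is 1.
    have hAz : A = 0 := by
      have h1 : A * (1 - C (G 0 * H 0) * X) = 0 := by
        rw [C_mul]
        linear_combination hA₁ - C (G 0) * X * hB₁
      refine (mul_eq_zero.mp h1).resolve_right fun h => ?_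
      simpa using congrArg (eval 0) h
    refine ⟨hAz, ?_⟩
    simpa [hAz] using hB₁

/-! ### Stripping layers by adjugates; degrees and top coefficients. -/

/-- The product of the adjugates of the first `k` transfer matrices, in the variable `y = -z`. -/
def strippingMatrix (G H : ℕ → ℝ) : ℕ → Matrix (Fin 2) (Fin 2) ℝ[X]
  | 0 => 1
  | k + 1 => !![1, -C (H k); -(C (G k) * X), 1] * strippingMatrix G H k

/-- The top coefficients of the two rows of `strippingMatrix`. -/
def strippingLead (G H : ℕ → ℝ) : ℕ → ℝ × ℝ
  | 0 => (1, 1)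
  | k + 1 => (-(H k * (strippingLead G H k).2), -(G k * (strippingLead G H k).1))

theorem strippingMatrix_succ_zero (G H : ℕ → ℝ) (k : ℕ) (j : Fin 2) :
    strippingMatrix G H (k + 1) 0 j =
      strippingMatrix G H k 0 j - C (H k) * strippingMatrix G H k 1 j := by
  simp [strippingMatrix, Matrix.mul_apply, Fin.sum_univ_two, sub_eq_add_neg]

theorem strippingMatrix_succ_one (G H : ℕ → ℝ) (k : ℕ) (j : Fin 2) :
    strippingMatrix G H (k + 1) 1 j =
      strippingMatrix G H k 1 j - C (G k) * (X * strippingMatrix G H k 0 j) := by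
  simp [strippingMatrix, Matrix.mul_apply, Fin.sum_univ_two, sub_eq_add_neg, mul_assoc, add_comm]

/-- Only the factor X in the second row raises degrees, and the rows feed each other, so degrees
grow by one every two steps. In row 0, with the constant term of the first entry fixed, k / 2 + (k +
1) / 2 = k coefficients remain free. -/
theorem strippingMatrix_coeff_eq_zero (G H : ℕ → ℝ) (k : ℕ) :
    (∀ i, k / 2 < i → (strippingMatrix G H k 0 0).coeff i = 0) ∧
    (∀ i, (k + 1) / 2 ≤ i → (strippingMatrix G H k 0 1).coeff i = 0) ∧
    (∀ i, (k + 1) / 2 < i → (strippingMatrix G H k 1 0).coeff i = 0) ∧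
    (∀ i, k / 2 < i → (strippingMatrix G H k 1 1).coeff i = 0) := by
  induction k with
  | zero =>
    refine ⟨fun i hi => ?_, fun i _ => ?_, fun i _ => ?_, fun i hi => ?_⟩ <;>
      simp [strippingMatrix, coeff_one] <;> omega
  | succ k ih =>
    obtain ⟨h1, h2, h3, h4⟩ := ih
    refine ⟨fun i hi => ?_, fun i hi => ?_, fun i hi => ?_, fun i hi => ?_⟩
    · rw [strippingMatrix_succ_zero, coeff_sub, coeff_C_mul, h1 i (by omega), h3 i (by omega)]
      simp
    · rw [strippingMatrix_succ_zero, coeff_sub, coeff_C_mul, h2 i (by omega), h4 i (by omega)]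
      simp
    · obtain ⟨i, rfl⟩ : ∃ i', i = i' + 1 := ⟨i - 1, by omega⟩
      rw [strippingMatrix_succ_one, coeff_sub, coeff_C_mul, coeff_X_mul, h3 (i + 1) (by omega),
        h1 i (by omega)]
      simp
    · obtain ⟨i, rfl⟩ : ∃ i', i = i' + 1 := ⟨i - 1, by omega⟩
      rw [strippingMatrix_succ_one, coeff_sub, coeff_C_mul, coeff_X_mul, h4 (i + 1) (by omega),
        h2 i (by omega)]
      simp

/-- At the top degree one of the two terms of the recurrence drops out, so top coefficients simply
multiply. In row 0 the top one lies in the first entry for even k and in the second for odd k. -/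
theorem strippingMatrix_coeff_top (G H : ℕ → ℝ) (k : ℕ) :
    (Even k → (strippingMatrix G H k 0 0).coeff (k / 2) = (strippingLead G H k).1 ∧
      (strippingMatrix G H k 1 1).coeff (k / 2) = (strippingLead G H k).2) ∧
    (Odd k → (strippingMatrix G H k 0 1).coeff (k / 2) = (strippingLead G H k).1 ∧
      (strippingMatrix G H k 1 0).coeff (k / 2 + 1) = (strippingLead G H k).2) := by
  induction k with
  | zero => simp [strippingMatrix, strippingLead]
  | succ k ih =>
    obtain ⟨h1, h2, h3, h4⟩ := strippingMatrix_coeff_eq_zero G H k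
    refine ⟨fun hk => ?_, fun hk => ?_⟩
    · have hk' : Odd k := by simpa [Nat.even_add_one] using hk
      obtain ⟨hB, hC⟩ := ih.2 hk'
      have e : (k + 1) / 2 = k / 2 + 1 := by
        obtain ⟨r, rfl⟩ := hk'
        omega
      rw [e]
      refine ⟨?_, ?_⟩
      · rw [strippingMatrix_succ_zero, coeff_sub, coeff_C_mul, h1 _ (by omega), hC]
        simp [strippingLead]
      · rw [strippingMatrix_succ_one, coeff_sub, coeff_C_mul, coeff_X_mul, h4 _ (by omega), hB]
        simp [strippingLead]
    · have hk' : Even k := by simpa [Nat.odd_add_one] using hk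
      obtain ⟨hA, hD⟩ := ih.1 hk'
      have e : (k + 1) / 2 = k / 2 := by
        obtain ⟨r, rfl⟩ := hk'
        omega
      rw [e]
      refine ⟨?_, ?_⟩
      · rw [strippingMatrix_succ_zero, coeff_sub, coeff_C_mul, h2 _ (by omega), hD]
        simp [strippingLead]
      · rw [strippingMatrix_succ_one, coeff_sub, coeff_C_mul, coeff_X_mul, h3 _ (by omega), hA]
        simp [strippingLead]

theorem strippingMatrix_eval_zero (G H : ℕ → ℝ) (k : ℕ) :
    (strippingMatrix G H k 0 0).eval 0 = 1 ∧ (strippingMatrix G H k 1 0).eval 0 = 0 := by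
  induction k with
  | zero => simp [strippingMatrix]
  | succ k ih => simp [strippingMatrix_succ_zero, strippingMatrix_succ_one, ih.1, ih.2]

/-- The adjugate of a layer times the layer is the scalar 1 - y G H. At a node 1 / (G H) of a
stripped layer the right sides vanish. -/
theorem strippingMatrix_eval (G H : ℕ → ℝ) (q p : ℕ → ℝ → ℝ) (k : ℕ)
    (hq : ∀ j < k, ∀ y, q j y = q (j + 1) y + H j * p (j + 1) y)
    (hp : ∀ j < k, ∀ y, p j y = y * G j * q (j + 1) y + p (j + 1) y) (y : ℝ) :
    (strippingMatrix G H k 0 0).eval y * q 0 y + (strippingMatrix G H k 0 1).eval y * p 0 y =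
      (∏ i ∈ Finset.range k, (1 - y * (G i * H i))) * q k y ∧
    (strippingMatrix G H k 1 0).eval y * q 0 y + (strippingMatrix G H k 1 1).eval y * p 0 y =
      (∏ i ∈ Finset.range k, (1 - y * (G i * H i))) * p k y := by
  induction k with
  | zero => simp [strippingMatrix]
  | succ k ih =>
    obtain ⟨h1, h2⟩ := ih (fun j hj => hq j (by omega)) (fun j hj => hp j (by omega))
    rw [hq k (by omega), hp k (by omega)] at *
    simp only [strippingMatrix_succ_zero, strippingMatrix_succ_one, eval_sub, eval_mul, eval_C,
      eval_X, Finset.prod_range_succ]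
    constructor
    · linear_combination h1 - H k * h2
    · linear_combination h2 - G k * y * h1

/-- Each step multiplies the product of the two leads by G H = 1 / E. Thus the second lead is known
once the first is, and only row 0 needs Cramer's rule. -/
theorem strippingLead_mul (E G H : ℕ → ℝ) (k : ℕ) (hGH : ∀ j < k, G j * H j * E j = 1) :
    (strippingLead G H k).1 * (strippingLead G H k).2 * ∏ i ∈ Finset.range k, E i = 1 := by
  induction k with
  | zero => simp [strippingLead]
  | succ k ih =>
    have h := ih fun j hj => hGH j (by omega)
    simp only [strippingLead, Finset.prod_range_succ]
    linear_combination h * (G k * H k * E k) + hGH k (by omega)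

/-! ### Cauchy–Stieltjes–Vandermonde determinants and Cramer's rule. -/

section Cramer

variable {k : ℕ} {E G H : ℕ → ℝ} {q p : ℕ → ℝ → ℝ} {ν : Measure ℝ} {c : ℝ}

/-- Splitting a sum over `Fin k` into its first `l` terms and the rest. -/
theorem sum_fin_ite_lt {l : ℕ} (hl : l ≤ k) (f g : ℕ → ℝ) :
    ∑ j : Fin k, (if (j : ℕ) < l then f j else g (j - l)) =
      ∑ j ∈ Finset.range l, f j + ∑ j ∈ Finset.range (k - l), g j := by
  obtain ⟨r, rfl⟩ := Nat.exists_eq_add_of_le hl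
  rw [Fin.sum_univ_eq_sum_range (fun j => if j < l then f j else g (j - l)),
    Finset.sum_range_add, Nat.add_sub_cancel_left]
  refine congrArg₂ _ (Finset.sum_congr rfl fun j hj => ?_) (Finset.sum_congr rfl fun j _ => ?_)
  · simp [Finset.mem_range.mp hj]
  · simp

theorem csvMatrix_mulVec {l : ℕ} (hl : l ≤ k) (s : ℕ) (e : Fin k → ℝ) (ν : Measure ℝ) (c : ℝ)
    (u w : ℕ → ℝ) (i : Fin k) :
    (csvMatrix l s e ν c).mulVec (fun j => if (j : ℕ) < l then u j else w (j - l)) i =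
      (∑ j ∈ Finset.range l, u j * e i ^ (s + j)) * shiftedStieltjes ν c (e i) +
        ∑ j ∈ Finset.range (k - l), w j * e i ^ j := by
  rw [Finset.sum_mul, ← sum_fin_ite_lt hl (fun j => u j * e i ^ (s + j) * shiftedStieltjes ν c (e i))
    (fun j => w j * e i ^ j)]
  simp only [Matrix.mulVec, dotProduct, csvMatrix, Matrix.of_apply]
  refine Finset.sum_congr rfl fun j _ => ?_
  split_ifs <;> ring

/-- A kernel vector lists the coefficients of a pair (A, B) solving the homogeneous interpolation
problem; the shift p = 1 is the condition A(0) = 0. -/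
theorem csvMatrix_det_ne_zero
    (hE : ∀ j < k, 0 < E j) (hinj : Set.InjOn E (Set.Iio k))
    (hGH : ∀ j < k, G j * H j * E j = 1)
    (hq : ∀ j < k, ∀ y, q j y = q (j + 1) y + H j * p (j + 1) y)
    (hp : ∀ j < k, ∀ y, p j y = y * G j * q (j + 1) y + p (j + 1) y)
    (hpos : ∀ j < k, ∀ y, 0 < y → p j y ≠ 0)
    (hW : ∀ i < k, q 0 (E i) = shiftedStieltjes ν c (E i) * p 0 (E i)) :
    (csvMatrix (k / 2) 1 (fun i : Fin k => E i) ν c).det ≠ 0 := by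
  intro hdet
  obtain ⟨v, hv, hv0⟩ := Matrix.exists_mulVec_eq_zero_iff.mpr hdet
  apply hv
  set l := k / 2 with hl
  have hlk : l ≤ k := by omega
  set v' : ℕ → ℝ := fun j => if h : j < k then v ⟨j, h⟩ else 0 with hv'
  have hvv : v = fun j : Fin k => if (j : ℕ) < l then v' j else (fun i => v' (l + i)) (j - l) := by
    ext j
    have hj := j.2
    split_ifs with h
    · simp [hv']
    · have : l + (j - l) = j := by omega
      simp [hv', this]
  set A : ℝ[X] := X * ∑ j ∈ Finset.range l, C (v' j) * X ^ j with hA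
  set B : ℝ[X] := ∑ j ∈ Finset.range (k - l), C (v' (l + j)) * X ^ j with hB
  have key : A = 0 ∧ B = 0 := by
    refine eq_zero_of_interpolates_zero k E G H q p hE hinj hGH hq hp hpos A B (by simp [hA])
      ?_ ?_ ?_
    · rw [degree_lt_iff_coeff_zero]
      intro m hm
      obtain ⟨m, rfl⟩ : ∃ m', m = m' + 1 := ⟨m - 1, by omega⟩
      rw [hA, coeff_X_mul, finsetSum_coeff]
      refine Finset.sum_eq_zero fun j hj => ?_
      rw [Finset.mem_range] at hj
      rw [coeff_C_mul_X_pow, if_neg (by omega)]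
    · rw [degree_lt_iff_coeff_zero]
      intro m hm
      rw [hB, finsetSum_coeff]
      refine Finset.sum_eq_zero fun j hj => ?_
      rw [Finset.mem_range] at hj
      rw [coeff_C_mul_X_pow, if_neg (by omega)]
    · intro i hi
      have h1 := congrFun hv0 ⟨i, hi⟩
      rw [hvv, csvMatrix_mulVec hlk 1 _ ν c v' (fun i => v' (l + i))] at h1
      rw [hW i hi]
      have eA : A.eval (E i) = ∑ j ∈ Finset.range l, v' j * E i ^ (1 + j) := by
        rw [hA, eval_mul, eval_X, eval_finsetSum, Finset.mul_sum]
        refine Finset.sum_congr rfl fun j _ => ?_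
        simp only [eval_mul, eval_C, eval_pow, eval_X]
        ring
      have eB : B.eval (E i) = ∑ j ∈ Finset.range (k - l), v' (l + j) * E i ^ j := by
        rw [hB, eval_finsetSum]
        simp
      rw [eA, eB]
      simp only [Pi.zero_apply] at h1
      linear_combination p 0 (E i) * h1
  ext j
  have hj := j.2
  rw [hvv]
  dsimp only
  split_ifs with h
  · have := congrArg (fun f => coeff f ((j : ℕ) + 1)) key.1
    simpa [hA, finsetSum_coeff, coeff_X_pow, h] using this
  · have := congrArg (fun f => coeff f ((j : ℕ) - l)) key.2
    have hjl : (j : ℕ) - l < k - l := by omega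
    simpa [hB, finsetSum_coeff, coeff_X_pow, hjl] using this

/-- The free coefficients of row 0 of the stripping matrix solve the CSV system with p = 1; the
constant term 1 of the first entry, moved to the right, gives minus the Stieltjes column. Cramer's
rule for the top coefficient puts that column in, and reordering yields the matrix with p = 0. -/
theorem abs_strippingLead_mul_abs_det
    (hE : ∀ j < k, 0 < E j) (hGH : ∀ j < k, G j * H j * E j = 1)
    (hq : ∀ j < k, ∀ y, q j y = q (j + 1) y + H j * p (j + 1) y)
    (hp : ∀ j < k, ∀ y, p j y = y * G j * q (j + 1) y + p (j + 1) y)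
    (hpos : ∀ j < k, ∀ y, 0 < y → p j y ≠ 0)
    (hW : ∀ i < k, q 0 (E i) = shiftedStieltjes ν c (E i) * p 0 (E i)) :
    |(strippingLead G H k).1| * |(csvMatrix (k / 2) 1 (fun i : Fin k => E i) ν c).det| =
      |(csvMatrix ((k + 1) / 2) 0 (fun i : Fin k => E i) ν c).det| := by
  rcases Nat.eq_zero_or_pos k with rfl | hk0
  · simp [strippingLead]
  obtain ⟨h1, h2, -, -⟩ := strippingMatrix_coeff_eq_zero G H k
  set A := strippingMatrix G H k 0 0 with hA
  set B := strippingMatrix G H k 0 1 with hB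
  set l := k / 2 with hl
  have hlk : l ≤ k := by omega
  set M := csvMatrix l 1 (fun i : Fin k => E i) ν c with hM
  set v : Fin k → ℝ := fun j => if (j : ℕ) < l then (fun i => A.coeff (i + 1)) j
    else (fun i => B.coeff i) (j - l) with hv
  have hMv : M.mulVec v = -fun i : Fin k => shiftedStieltjes ν c (E i) := by
    ext i
    rw [hM, hv, csvMatrix_mulVec hlk 1 _ ν c (fun i => A.coeff (i + 1)) (fun i => B.coeff i)]
    have evA : A.eval (E i) = 1 + ∑ j ∈ Finset.range l, A.coeff (j + 1) * E i ^ (1 + j) := by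
      have hd : A.natDegree < l + 1 := by
        have : A.natDegree ≤ l := natDegree_le_iff_coeff_eq_zero.mpr fun m hm => h1 m hm
        omega
      rw [eval_eq_sum_range' hd, Finset.sum_range_succ', add_comm]
      have : A.coeff 0 = 1 := by
        rw [coeff_zero_eq_eval_zero]
        exact (strippingMatrix_eval_zero G H k).1
      simp [this, add_comm]
    have evB : B.eval (E i) = ∑ j ∈ Finset.range (k - l), B.coeff j * E i ^ j := by
      have hd : B.natDegree < k - l := by
        have : B.natDegree ≤ (k + 1) / 2 - 1 :=
          natDegree_le_iff_coeff_eq_zero.mpr fun m hm => h2 m (by omega)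
        omega
      rw [eval_eq_sum_range' hd]
    have h3 := (strippingMatrix_eval G H q p k hq hp (E i)).1
    rw [Finset.prod_eq_zero (Finset.mem_range.mpr i.2)
      (by linear_combination -hGH i i.2), zero_mul, hW i i.2] at h3
    have h4 : A.eval (E i) * shiftedStieltjes ν c (E i) + B.eval (E i) = 0 := by
      refine (mul_eq_zero.mp ?_).resolve_right (hpos 0 hk0 _ (hE i i.2))
      linear_combination h3
    rw [evA, evB] at h4
    simp only [Pi.neg_apply]
    linear_combination h4
  -- The top coefficient is the last unknown of the first block for even k and the last unknown of
  -- all for odd k.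
  obtain ⟨js, hjs, hlead⟩ : ∃ js : Fin k, (js : ℕ) + 1 = (if Even k then l else k) ∧
      v js = (strippingLead G H k).1 := by
    obtain ⟨he, ho⟩ := strippingMatrix_coeff_top G H k
    rcases Nat.even_or_odd k with hk | hk
    · have hl0 : 0 < l := by
        obtain ⟨r, hr⟩ := hk
        omega
      refine ⟨⟨l - 1, by omega⟩, by simp only [hk, if_true]; omega, ?_⟩
      have : l - 1 + 1 = l := by omega
      simp only [hv, this, show l - 1 < l by omega, if_true]
      exact (he hk).1
    · have hk' := Nat.not_even_iff_odd.mpr hk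
      refine ⟨⟨k - 1, by omega⟩, by simp only [hk', if_false]; omega, ?_⟩
      have hkl : ¬ (k - 1 < l) := by
        obtain ⟨r, hr⟩ := hk
        omega
      have : k - 1 - l = k / 2 := by
        obtain ⟨r, hr⟩ := hk
        omega
      simp only [hv, hkl, if_false, this]
      exact (ho hk).1
  have hcr : M.det * v js = (M.updateCol js (-fun i : Fin k => shiftedStieltjes ν c (E i))).det := by
    rw [← Matrix.cramer_apply, Matrix.cramer_eq_adjugate_mulVec, ← hMv, Matrix.mulVec_mulVec,
      Matrix.adjugate_mul]
    simp [Matrix.smul_mulVec]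
  have hneg : (M.updateCol js (-fun i : Fin k => shiftedStieltjes ν c (E i))).det =
      -(M.updateCol js (fun i : Fin k => shiftedStieltjes ν c (E i))).det := by
    have := Matrix.det_updateCol_smul M js (-1) (fun i : Fin k => shiftedStieltjes ν c (E i))
    simpa using this
  rw [← hlead, ← abs_mul, mul_comm, hcr, hneg, abs_neg]
  -- Cycling the new column to the front makes the Stieltjes powers start at 0. For even k the block
  -- sizes are unchanged; for odd k the last Vandermonde column is lost and the first block grows by
  -- one.
  have hperm : M.updateCol js (fun i : Fin k => shiftedStieltjes ν c (E i)) =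
      (csvMatrix ((k + 1) / 2) 0 (fun i : Fin k => E i) ν c).submatrix (Equiv.refl _)
        (Fin.cycleRange js) := by
    ext i j
    have hj := j.2
    rcases lt_trichotomy j js with h | h | h
    · have hc := Fin.coe_cycleRange_of_lt h
      simp only [Matrix.submatrix_apply, Matrix.updateCol_apply, h.ne, if_false, hM, csvMatrix,
        Matrix.of_apply, hc, Equiv.refl_apply]
      have h' : (j : ℕ) < js := h
      rcases Nat.even_or_odd k with hk | hk
      · simp only [hk, if_true] at hjs
        obtain ⟨r, hr⟩ := hk
        rw [if_pos (by omega), if_pos (by omega)]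
        congr 2
        omega
      · have hk' := Nat.not_even_iff_odd.mpr hk
        simp only [hk', if_false] at hjs
        obtain ⟨r, hr⟩ := hk
        by_cases hjl : (j : ℕ) < l
        · rw [if_pos hjl, if_pos (by omega)]
          congr 2
          omega
        · rw [if_neg hjl, if_neg (by omega)]
          congr 1
          omega
    · have : NeZero k := ⟨hk0.ne'⟩
      subst h
      simp only [Matrix.submatrix_apply, Matrix.updateCol_apply, if_true, csvMatrix,
        Matrix.of_apply, Fin.cycleRange_self, Equiv.refl_apply, Fin.val_zero]
      have : 0 < (k + 1) / 2 := by omega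
      simp [this]
    · have hc := Fin.cycleRange_of_gt h
      simp only [Matrix.submatrix_apply, Matrix.updateCol_apply, h.ne', if_false, hM, csvMatrix,
        Matrix.of_apply, hc, Equiv.refl_apply]
      have h' : (js : ℕ) < j := h
      rcases Nat.even_or_odd k with hk | hk
      · simp only [hk, if_true] at hjs
        obtain ⟨r, hr⟩ := hk
        rw [if_neg (by omega), if_neg (by omega)]
        congr 1
        omega
      · have hk' := Nat.not_even_iff_odd.mpr hk
        simp only [hk', if_false] at hjs
        omega
  rw [hperm, Matrix.abs_det_submatrix_equiv_equiv]

end Cramer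

/-! ### Interlacing roots and partial fractions. -/

/-- A real polynomial with alternating signs at `n + 1` increasing points has `n` roots that
interlace these points. -/
theorem exists_interlacing_roots {n : ℕ} (f : ℝ → ℝ) (hf : Continuous f) (x : Fin (n + 1) → ℝ)
    (hx : StrictMono x) (hsign : ∀ i : Fin n, f (x i.castSucc) * f (x i.succ) < 0) :
    ∃ ξ : Fin n → ℝ, StrictMono ξ ∧ (∀ i, x i.castSucc < ξ i) ∧ (∀ i, ξ i < x i.succ) ∧
      ∀ i, f (ξ i) = 0 := by
  have h : ∀ i : Fin n, ∃ t, x i.castSucc < t ∧ t < x i.succ ∧ f t = 0 := by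
    intro i
    have hlt : x i.castSucc < x i.succ := hx Fin.castSucc_lt_succ
    have : ∃ t ∈ Set.Ioo (x i.castSucc) (x i.succ), f t = 0 := by
      rcases mul_neg_iff.mp (hsign i) with ⟨h1, h2⟩ | ⟨h1, h2⟩
      · exact intermediate_value_Ioo' hlt.le hf.continuousOn ⟨h2, h1⟩
      · exact intermediate_value_Ioo hlt.le hf.continuousOn ⟨h1, h2⟩
    obtain ⟨t, ht, h0⟩ := this
    exact ⟨t, ht.1, ht.2, h0⟩
  choose ξ h1 h2 h3 using h
  refine ⟨ξ, fun i j hij => ?_, h1, h2, h3⟩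
  calc ξ i < x i.succ := h2 i
    _ ≤ x j.castSucc := hx.monotone (by rw [Fin.le_def]; simpa using hij)
    _ < ξ j := h1 j

section PartialFractions

variable {K : ℕ} (ζ a : Fin K → ℝ) (c : ℝ)

/-- `∑ j, a_j ∏_{i ≠ j} (X + ζ_i)`. -/
def cofactorSum : ℝ[X] := ∑ j, C (a j) * ∏ i ∈ Finset.univ.erase j, (X + C (ζ i))

theorem prod_X_add_C_eval (s : Finset (Fin K)) (y : ℝ) :
    (∏ i ∈ s, (X + C (ζ i))).eval y = ∏ i ∈ s, (y + ζ i) := by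
  simp [eval_prod]

theorem cofactorSum_eval (y : ℝ) :
    (cofactorSum ζ a).eval y = ∑ j, a j * ∏ i ∈ Finset.univ.erase j, (y + ζ i) := by
  simp [cofactorSum, eval_finsetSum, eval_prod]

/-- Away from the nodes the cofactor sum is the partial fraction sum times the full product. -/
theorem cofactorSum_eval_of_ne (y : ℝ) (hy : ∀ j, y + ζ j ≠ 0) :
    (cofactorSum ζ a).eval y = (∑ j, a j / (ζ j + y)) * ∏ i, (y + ζ i) := by
  rw [cofactorSum_eval, Finset.sum_mul]
  refine Finset.sum_congr rfl fun j _ => ?_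
  rw [← Finset.mul_prod_erase _ _ (Finset.mem_univ j), add_comm (ζ j) y]
  field_simp [hy j]

theorem cofactorSum_eval_node (j : Fin K) :
    (cofactorSum ζ a).eval (-ζ j) = a j * ∏ i ∈ Finset.univ.erase j, (ζ i - ζ j) := by
  rw [cofactorSum_eval, Finset.sum_eq_single j]
  · simp [sub_eq_neg_add]
  · intro i _ hij
    rw [Finset.prod_eq_zero (Finset.mem_erase.mpr ⟨hij.symm, Finset.mem_univ j⟩) (by ring), mul_zero]
  · simp

theorem cofactorSum_degree_lt : (cofactorSum ζ a).degree < (K : WithBot ℕ) := by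
  refine (degree_sum_le _ _).trans_lt ((Finset.sup_lt_iff (WithBot.bot_lt_coe K)).mpr fun j _ => ?_)
  refine (degree_C_mul_le_degree _ _).trans_lt ?_
  rw [degree_prod]
  have hK : 0 < K := j.pos
  simp only [degree_X_add_C, Finset.sum_const, Finset.card_erase_of_mem (Finset.mem_univ j),
    Finset.card_univ, Fintype.card_fin, nsmul_eq_mul, mul_one]
  exact Nat.cast_lt.mpr (by omega)

theorem cofactorSum_coeff_top : (cofactorSum ζ a).coeff (K - 1) = ∑ j, a j := by
  rw [cofactorSum, finsetSum_coeff]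
  refine Finset.sum_congr rfl fun j _ => ?_
  have hm : (∏ i ∈ Finset.univ.erase j, (X + C (ζ i))).Monic :=
    monic_prod_of_monic _ _ fun i _ => monic_X_add_C _
  have hd : (∏ i ∈ Finset.univ.erase j, (X + C (ζ i))).natDegree = K - 1 := by
    rw [natDegree_prod_of_monic _ _ fun i _ => monic_X_add_C _]
    simp [Finset.card_erase_of_mem]
  rw [coeff_C_mul]
  rw [← hd, hm.coeff_natDegree, mul_one]

/-- The numerator of `c + ∑ j, a_j / (ζ_j + y)`. -/
def weylNumerator : ℝ[X] := C c * ∏ i, (X + C (ζ i)) + cofactorSum ζ a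

theorem weylNumerator_eval_of_ne (y : ℝ) (hy : ∀ j, y + ζ j ≠ 0) :
    (weylNumerator ζ a c).eval y = (c + ∑ j, a j / (ζ j + y)) * ∏ i, (y + ζ i) := by
  rw [weylNumerator, eval_add, cofactorSum_eval_of_ne ζ a y hy, eval_mul, eval_C, prod_X_add_C_eval]
  ring

theorem weylNumerator_eval_node (j : Fin K) :
    (weylNumerator ζ a c).eval (-ζ j) = a j * ∏ i ∈ Finset.univ.erase j, (ζ i - ζ j) := by
  rw [weylNumerator, eval_add, cofactorSum_eval_node, eval_mul, prod_X_add_C_eval,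
    Finset.prod_eq_zero (Finset.mem_univ j) (by ring)]
  simp

/-- The pole of the cofactor sum with coefficients `-a_j / (ζ_j - ξ)` matches the removal of the
root `-ξ` of `weylNumerator`. -/
theorem mul_cofactorSum_root {ξ : ℝ} (hξ : ∀ j, ζ j - ξ ≠ 0)
    (hroot : (weylNumerator ζ a c).eval (-ξ) = 0) :
    (X + C ξ) * cofactorSum ζ (fun j => -(a j / (ζ j - ξ))) = weylNumerator ζ a c := by
  have hF : c + ∑ j, a j / (ζ j - ξ) = 0 := by
    have hne : ∀ j, -ξ + ζ j ≠ 0 := fun j => by rw [neg_add_eq_sub]; exact hξ j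
    rw [weylNumerator_eval_of_ne ζ a c _ hne] at hroot
    simpa [sub_eq_add_neg] using
      (mul_eq_zero.mp hroot).resolve_right (Finset.prod_ne_zero_iff.mpr fun j _ => hne j)
  have hc : c = -∑ j, a j / (ζ j - ξ) := by linear_combination hF
  rw [weylNumerator, hc, cofactorSum, cofactorSum, Finset.mul_sum, map_neg, map_sum, neg_mul,
    Finset.sum_mul, ← Finset.sum_neg_distrib, ← Finset.sum_add_distrib]
  refine Finset.sum_congr rfl fun j _ => ?_
  rw [← Finset.mul_prod_erase _ _ (Finset.mem_univ j)]
  have : a j = a j / (ζ j - ξ) * (ζ j - ξ) := by field_simp [hξ j]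
  have h2 : (C (a j) : ℝ[X]) = C (a j / (ζ j - ξ)) * (C (ζ j) - C ξ) := by
    rw [← C_sub, ← C_mul, ← this]
  rw [h2, map_neg]
  ring

end PartialFractions

/-! ### The quotient S/F is again a Stieltjes sum. -/

section StieltjesStep

variable {K n : ℕ} {ζ β : Fin K → ℝ} {c : ℝ} {ξ : Fin n → ℝ}

/-- The residue at a root `-ξ`. -/
def stepResidue (ζ β : Fin K → ℝ) (c ξ : ℝ) : ℝ :=
  (c + ∑ j, β j) / (ξ * ∑ j, ζ j * β j / (ζ j - ξ) ^ 2)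

theorem stepResidue_pos (hK : 0 < K) (hζ : ∀ j, 0 < ζ j) (hβ : ∀ j, 0 < β j) (hc : 0 ≤ c)
    {x : ℝ} (hx : 0 < x) (hne : ∀ j, ζ j - x ≠ 0) : 0 < stepResidue ζ β c x := by
  have : Nonempty (Fin K) := ⟨⟨0, hK⟩⟩
  have h1 : 0 < ∑ j, β j := Finset.sum_pos (fun j _ => hβ j) Finset.univ_nonempty
  have h2 : 0 < ∑ j, ζ j * β j / (ζ j - x) ^ 2 := Finset.sum_pos
    (fun j _ => div_pos (mul_pos (hζ j) (hβ j)) (by have := hne j; positivity))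
    Finset.univ_nonempty
  unfold stepResidue
  positivity

/-- This is the residue S(-x)/F'(-x) with denominators cleared: the cofactor sum on the right is the
numerator of F divided by X + x, so its value at -x is a derivative. -/
theorem cofactorSum_eval_root (hK : 0 < K) (hζ : ∀ j, 0 < ζ j) (hβ : ∀ j, 0 < β j)
    {x : ℝ} (hx : 0 < x) (hne : ∀ j, ζ j - x ≠ 0)
    (hroot : (weylNumerator ζ (fun j => ζ j * β j) c).eval (-x) = 0) :
    (cofactorSum ζ β).eval (-x) = stepResidue ζ β c x *
      (cofactorSum ζ (fun j => -(ζ j * β j / (ζ j - x)))).eval (-x) := by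
  have : Nonempty (Fin K) := ⟨⟨0, hK⟩⟩
  have hne' : ∀ j, -x + ζ j ≠ 0 := fun j => by rw [neg_add_eq_sub]; exact hne j
  have hprod : ∏ i, (-x + ζ i) ≠ 0 := Finset.prod_ne_zero_iff.mpr fun j _ => hne' j
  rw [weylNumerator_eval_of_ne _ _ _ _ hne'] at hroot
  have hF := (mul_eq_zero.mp hroot).resolve_right hprod
  simp only [← sub_eq_add_neg] at hF
  rw [cofactorSum_eval_of_ne _ _ _ hne', cofactorSum_eval_of_ne _ _ _ hne', ← mul_assoc]
  congr 1
  simp only [← sub_eq_add_neg]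
  have h2 : 0 < ∑ j, ζ j * β j / (ζ j - x) ^ 2 := Finset.sum_pos
    (fun j _ => div_pos (mul_pos (hζ j) (hβ j)) (by have := hne j; positivity))
    Finset.univ_nonempty
  have h3 : ∑ j, -(ζ j * β j / (ζ j - x)) / (ζ j - x) = -∑ j, ζ j * β j / (ζ j - x) ^ 2 := by
    rw [← Finset.sum_neg_distrib]
    refine Finset.sum_congr rfl fun j _ => ?_
    have := hne j
    field_simp
  -- Since ζ/(ζ - x) = 1 + x/(ζ - x), the equation F(-x) = 0 determines S(-x).
  have h4 : x * ∑ j, β j / (ζ j - x) = -(c + ∑ j, β j) := by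
    have : ∑ j, ζ j * β j / (ζ j - x) = ∑ j, β j + x * ∑ j, β j / (ζ j - x) := by
      rw [Finset.mul_sum, ← Finset.sum_add_distrib]
      refine Finset.sum_congr rfl fun j _ => ?_
      have := hne j
      field_simp
      ring
    rw [this] at hF
    linear_combination hF
  rw [h3, stepResidue]
  have hx' := hx.ne'
  have h2' := h2.ne'
  field_simp
  linear_combination h4

/-- Partial fractions of the quotient of two Stieltjes sums, given the roots of the denominator. -/
theorem stieltjes_quotient (hK : 0 < K) (hζ : ∀ j, 0 < ζ j) (hβ : ∀ j, 0 < β j)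
    (hξ : Function.Injective ξ) (hξpos : ∀ l, 0 < ξ l) (hne : ∀ l j, ζ j - ξ l ≠ 0)
    (hroot : ∀ l, (weylNumerator ζ (fun j => ζ j * β j) c).eval (-ξ l) = 0) (d : ℝ)
    (hdeg : (cofactorSum ζ β - (C d * weylNumerator ζ (fun j => ζ j * β j) c +
      ∑ l, C (stepResidue ζ β c (ξ l)) *
        cofactorSum ζ (fun j => -(ζ j * β j / (ζ j - ξ l))))).degree < (n : WithBot ℕ))
    {y : ℝ} (hy : 0 < y) :
    ∑ j, β j / (ζ j + y) = (d + ∑ l, stepResidue ζ β c (ξ l) / (ξ l + y)) *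
      (c + ∑ j, ζ j * β j / (ζ j + y)) := by
  set P := weylNumerator ζ (fun j => ζ j * β j) c with hP
  have hPR : ∀ l, (X + C (ξ l)) * cofactorSum ζ (fun j => -(ζ j * β j / (ζ j - ξ l))) = P :=
    fun l => mul_cofactorSum_root ζ _ c (hne l) (hroot l)
  -- The difference has degree below n, so agreement at the n points -ξ m suffices. There only the
  -- m-th summand survives.
  have hQ : cofactorSum ζ β = C d * P + ∑ l, C (stepResidue ζ β c (ξ l)) *
        cofactorSum ζ (fun j => -(ζ j * β j / (ζ j - ξ l))) := by
    refine eq_of_degree_sub_lt_of_eval_index_eq (s := (Finset.univ : Finset (Fin n)))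
      (v := fun l => -ξ l) (fun i _ j _ hij => hξ (neg_injective hij)) (by simpa using hdeg) ?_
    intro m _
    rw [eval_add, eval_mul, hroot m, mul_zero, zero_add, eval_finsetSum,
      Finset.sum_eq_single m, eval_mul, eval_C]
    · exact cofactorSum_eval_root hK hζ hβ (hξpos m) (hne m) (hroot m)
    · intro l _ hlm
      have h1 := congrArg (eval (-ξ m)) (hPR l)
      rw [hroot m, eval_mul] at h1
      rw [eval_mul, (mul_eq_zero.mp h1).resolve_left, mul_zero]
      simp only [eval_add, eval_X, eval_C]
      intro h
      exact hlm (hξ (by linear_combination h))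
    · simp
  have hyne : ∀ j, y + ζ j ≠ 0 := fun j => (add_pos hy (hζ j)).ne'
  have h1 := congrArg (eval y) hQ
  have h3 : ∀ l, (cofactorSum ζ (fun j => -(ζ j * β j / (ζ j - ξ l)))).eval y =
      P.eval y / (ξ l + y) := by
    intro l
    rw [← hPR l]
    have := (add_pos hy (hξpos l)).ne'
    have := (add_pos (hξpos l) hy).ne'
    simp only [eval_mul, eval_add, eval_X, eval_C]
    field_simp
    ring
  rw [eval_add, eval_mul, eval_C, eval_finsetSum, cofactorSum_eval_of_ne _ _ _ hyne] at h1
  simp only [eval_mul, eval_C, h3] at h1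
  have h4 : ∑ l, stepResidue ζ β c (ξ l) * (P.eval y / (ξ l + y)) =
      (∑ l, stepResidue ζ β c (ξ l) / (ξ l + y)) * P.eval y := by
    rw [Finset.sum_mul]
    exact Finset.sum_congr rfl fun l _ => by ring
  rw [h4, ← add_mul, hP, weylNumerator_eval_of_ne _ _ _ _ hyne, ← mul_assoc] at h1
  exact mul_right_cancel₀ (Finset.prod_ne_zero_iff.mpr fun j _ => hyne j) h1

/-- The values of the numerator at consecutive nodes have opposite signs. -/
theorem weylNumerator_nodes_sign {a : Fin (n + 1) → ℝ} {ζ : Fin (n + 1) → ℝ} (hζ : StrictMono ζ)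
    (ha : ∀ j, 0 < a j) (i : Fin n) :
    (weylNumerator ζ a c).eval (-ζ i.castSucc) * (weylNumerator ζ a c).eval (-ζ i.succ) < 0 := by
  rw [weylNumerator_eval_node, weylNumerator_eval_node]
  have hlt : i.castSucc < i.succ := Fin.castSucc_lt_succ
  rw [← Finset.mul_prod_erase (Finset.univ.erase i.castSucc) _
      (Finset.mem_erase.mpr ⟨hlt.ne', Finset.mem_univ i.succ⟩),
    ← Finset.mul_prod_erase (Finset.univ.erase i.succ) _
      (Finset.mem_erase.mpr ⟨hlt.ne, Finset.mem_univ i.castSucc⟩),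
    Finset.erase_right_comm (a := i.succ)]
  set s := (Finset.univ.erase i.castSucc).erase i.succ with hs
  have hprod : 0 < (∏ j ∈ s, (ζ j - ζ i.castSucc)) * ∏ j ∈ s, (ζ j - ζ i.succ) := by
    rw [← Finset.prod_mul_distrib]
    refine Finset.prod_pos fun j hj => ?_
    simp only [hs, Finset.mem_erase, Finset.mem_univ, and_true] at hj
    rcases lt_or_ge j i.castSucc with h | h
    · exact mul_pos_of_neg_of_neg (sub_neg.mpr (hζ h)) (sub_neg.mpr (hζ (h.trans hlt)))
    · have h' : i.castSucc < j := lt_of_le_of_ne h (Ne.symm hj.2)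
      have h'' : i.succ < j := lt_of_le_of_ne (Fin.castSucc_lt_iff_succ_le.mp h') (Ne.symm hj.1)
      exact mul_pos (sub_pos.mpr (hζ h')) (sub_pos.mpr (hζ h''))
  have hd : 0 < ζ i.succ - ζ i.castSucc := sub_pos.mpr (hζ hlt)
  have := mul_pos (mul_pos (mul_pos (ha i.castSucc) (ha i.succ)) (mul_pos hd hd)) hprod
  linarith

/-- For c = 0 the n gaps between nodes contain all n zeros of F, and S/F tends to ∑ β / ∑ ζ β at
infinity, which is the constant d. -/
theorem stieltjes_step_even {ζ β : Fin (n + 1) → ℝ} (hζpos : ∀ j, 0 < ζ j) (hζ : StrictMono ζ)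
    (hβ : ∀ j, 0 < β j) :
    ∃ (d : ℝ) (ξ γ : Fin n → ℝ), 0 < d ∧ (∀ l, 0 < ξ l) ∧ StrictMono ξ ∧ (∀ l, 0 < γ l) ∧
      ∀ y, 0 < y → ∑ j, β j / (ζ j + y) = (d + ∑ l, γ l / (ξ l + y)) *
        (0 + ∑ j, ζ j * β j / (ζ j + y)) := by
  have ha : ∀ j, 0 < ζ j * β j := fun j => mul_pos (hζpos j) (hβ j)
  obtain ⟨ξ, hξ, hl, hr, h0⟩ := exists_interlacing_roots
    (fun t => (weylNumerator ζ (fun j => ζ j * β j) 0).eval (-t)) (by fun_prop) ζ hζ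
    (weylNumerator_nodes_sign hζ ha)
  have hξpos : ∀ l, 0 < ξ l := fun l => (hζpos _).trans (hl l)
  have hne : ∀ l j, ζ j - ξ l ≠ 0 := by
    intro l j
    rcases le_or_gt j l.castSucc with h | h
    · exact (sub_neg.mpr ((hζ.monotone h).trans_lt (hl l))).ne
    · exact (sub_pos.mpr ((hr l).trans_le (hζ.monotone (Fin.castSucc_lt_iff_succ_le.mp h)))).ne'
  have hSa : 0 < ∑ j, ζ j * β j := Finset.sum_pos (fun j _ => ha j) Finset.univ_nonempty
  have hSb : 0 < ∑ j, β j := Finset.sum_pos (fun j _ => hβ j) Finset.univ_nonempty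
  have hsum : ∀ l, ∑ j, -(ζ j * β j / (ζ j - ξ l)) = 0 := by
    intro l
    have hne' : ∀ j, -ξ l + ζ j ≠ 0 := fun j => by rw [neg_add_eq_sub]; exact hne l j
    have := h0 l
    rw [weylNumerator_eval_of_ne _ _ _ _ hne'] at this
    have h := (mul_eq_zero.mp this).resolve_right (Finset.prod_ne_zero_iff.mpr fun j _ => hne' j)
    rw [Finset.sum_neg_distrib]
    simpa [sub_eq_add_neg] using h
  refine ⟨(∑ j, β j) / ∑ j, ζ j * β j, ξ, fun l => stepResidue ζ β 0 (ξ l), div_pos hSb hSa,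
    hξpos, hξ, fun l => stepResidue_pos n.succ_pos hζpos hβ le_rfl (hξpos l) (hne l),
    fun y hy => stieltjes_quotient n.succ_pos hζpos hβ hξ.injective hξpos hne h0 _ ?_ hy⟩
  -- The choice of d cancels the coefficient of degree n; the other summands have none, by `hsum`.
  rw [degree_lt_iff_coeff_zero]
  intro m hm
  simp only [weylNumerator, map_zero, zero_mul, zero_add, coeff_sub, coeff_add, coeff_C_mul,
    finsetSum_coeff]
  rcases hm.eq_or_lt with rfl | hm
  · have htop : ∀ a : Fin (n + 1) → ℝ, (cofactorSum ζ a).coeff n = ∑ j, a j := fun a => by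
      simpa using cofactorSum_coeff_top ζ a
    simp only [htop, hsum, mul_zero, Finset.sum_const_zero, add_zero]
    field_simp
    ring
  · have htop : ∀ a : Fin (n + 1) → ℝ, (cofactorSum ζ a).coeff m = 0 := fun a =>
      coeff_eq_zero_of_degree_lt ((cofactorSum_degree_lt ζ a).trans_le (by exact_mod_cast hm))
    simp [htop]

/-- For c > 0 there is one more zero beyond the last node, because F(-t) becomes positive for large
t. Now S/F decays at infinity, so no constant appears. -/
theorem stieltjes_step_odd {ζ β : Fin n → ℝ} (hζpos : ∀ j, 0 < ζ j) (hζ : StrictMono ζ)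
    (hβ : ∀ j, 0 < β j) (hc : 0 < c) :
    ∃ (ξ γ : Fin n → ℝ), (∀ l, 0 < ξ l) ∧ StrictMono ξ ∧ (∀ l, 0 < γ l) ∧
      ∀ y, 0 < y → ∑ j, β j / (ζ j + y) = (0 + ∑ l, γ l / (ξ l + y)) *
        (c + ∑ j, ζ j * β j / (ζ j + y)) := by
  rcases n with _ | n
  · exact ⟨ζ, β, hζpos, hζ, hβ, fun y _ => by simp⟩
  have ha : ∀ j, 0 < ζ j * β j := fun j => mul_pos (hζpos j) (hβ j)
  have hSa : 0 < ∑ j, ζ j * β j := Finset.sum_pos (fun j _ => ha j) Finset.univ_nonempty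
  set P := weylNumerator ζ (fun j => ζ j * β j) c with hP
  -- At y = -M every denominator has modulus at least ∑ ζ β / c + 1, so the sum stays above -c.
  set M := ζ (Fin.last n) + (∑ j, ζ j * β j) / c + 1 with hM
  have hMgap : ∀ j, (∑ j, ζ j * β j) / c + 1 ≤ M - ζ j := fun j => by
    have := hζ.monotone (Fin.le_last j)
    linarith
  have hgap : 0 < (∑ j, ζ j * β j) / c := div_pos hSa hc
  have hζM : ∀ j, ζ j < M := fun j => by linarith [hMgap j]
  have hFM : 0 < c + ∑ j, ζ j * β j / (ζ j + -M) := by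
    have h1 : ∀ j, -(ζ j * β j / ((∑ j, ζ j * β j) / c + 1)) ≤ ζ j * β j / (ζ j + -M) := by
      intro j
      rw [show ζ j + -M = -(M - ζ j) by ring, div_neg, neg_le_neg_iff]
      exact div_le_div_of_nonneg_left (ha j).le (by linarith) (hMgap j)
    have h2 := Finset.sum_le_sum fun j (_ : j ∈ Finset.univ) => h1 j
    rw [Finset.sum_neg_distrib, ← Finset.sum_div] at h2
    have h3 : (∑ j, ζ j * β j) / ((∑ j, ζ j * β j) / c + 1) < c := by
      rw [div_lt_iff₀ (by linarith)]
      field_simp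
      linarith
    linarith
  have hx : StrictMono (Fin.snoc ζ M : Fin (n + 2) → ℝ) := by
    intro i j hij
    induction j using Fin.lastCases with
    | last =>
      induction i using Fin.lastCases with
      | last => exact absurd hij (lt_irrefl _)
      | cast i => simpa using hζM i
    | cast j =>
      induction i using Fin.lastCases with
      | last => exact absurd hij (not_lt.mpr (Fin.le_last _))
      | cast i => simpa using hζ (by simpa using hij)
  have hsign : ∀ i : Fin (n + 1),
      P.eval (-(Fin.snoc ζ M : Fin (n + 2) → ℝ) i.castSucc) *
        P.eval (-(Fin.snoc ζ M : Fin (n + 2) → ℝ) i.succ) < 0 := by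
    intro i
    induction i using Fin.lastCases with
    | last =>
      rw [Fin.snoc_castSucc, Fin.succ_last, Fin.snoc_last, hP, weylNumerator_eval_node,
        weylNumerator_eval_of_ne _ _ _ _ fun j => by linarith [hζM j, (hζM j).ne],
        ← Finset.mul_prod_erase _ _ (Finset.mem_univ (Fin.last n))]
      have hprod : 0 < (∏ i ∈ Finset.univ.erase (Fin.last n), (ζ i - ζ (Fin.last n))) *
          ∏ i ∈ Finset.univ.erase (Fin.last n), (-M + ζ i) := by
        rw [← Finset.prod_mul_distrib]
        refine Finset.prod_pos fun j hj => ?_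
        have hj' : j < Fin.last n := Fin.lt_last_iff_ne_last.mpr (Finset.ne_of_mem_erase hj)
        exact mul_pos_of_neg_of_neg (sub_neg.mpr (hζ hj')) (by linarith [hζM j])
      have h1 := mul_pos (mul_pos (mul_pos (ha (Fin.last n)) hFM) hprod)
        (sub_pos.mpr (hζM (Fin.last n)))
      linarith
    | cast i =>
      rw [Fin.snoc_castSucc, ← Fin.castSucc_succ, Fin.snoc_castSucc]
      exact weylNumerator_nodes_sign hζ ha i
  obtain ⟨ξ, hξ, hl, hr, h0⟩ := exists_interlacing_roots (fun t => P.eval (-t)) (by fun_prop)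
    (Fin.snoc ζ M : Fin (n + 2) → ℝ) hx hsign
  have hl' : ∀ l, ζ l < ξ l := fun l => by simpa using hl l
  have hξpos : ∀ l, 0 < ξ l := fun l => (hζpos l).trans (hl' l)
  have hne : ∀ l j, ζ j - ξ l ≠ 0 := by
    intro l j
    rcases le_or_gt j l with h | h
    · exact (sub_neg.mpr ((hζ.monotone h).trans_lt (hl' l))).ne
    · refine (sub_pos.mpr ((hr l).trans_le ?_)).ne'
      have h2 : (Fin.snoc ζ M : Fin (n + 2) → ℝ) j.castSucc = ζ j := Fin.snoc_castSucc ..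
      rw [← h2]
      exact hx.monotone (by rw [Fin.le_def]; simpa using h)
  refine ⟨ξ, fun l => stepResidue ζ β c (ξ l), hξpos, hξ,
    fun l => stepResidue_pos n.succ_pos hζpos hβ hc.le (hξpos l) (hne l),
    fun y hy => stieltjes_quotient n.succ_pos hζpos hβ hξ.injective hξpos hne h0 _ ?_ hy⟩
  rw [degree_lt_iff_coeff_zero]
  intro m hm
  have htop : ∀ a : Fin (n + 1) → ℝ, (cofactorSum ζ a).coeff m = 0 := fun a =>
    coeff_eq_zero_of_degree_lt ((cofactorSum_degree_lt ζ a).trans_le (by exact_mod_cast hm))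
  simp [htop, finsetSum_coeff]

end StieltjesStep

/-! ### The recurrence at z = -y and existence by induction. -/

theorem rodSolution_zero {N : ℕ} (g h : Fin N → ℝ) : rodSolution g h 0 = ![0, 1] := rfl

theorem rodSolution_succ {N : ℕ} (g h : Fin N → ℝ) (i : Fin N) :
    rodSolution g h i.succ = (transferMatrix (g i) (h i)).mulVec (rodSolution g h i.castSucc) :=
  Fin.induction_succ ..

theorem rodSolution_succ_eval_zero {N : ℕ} (g h : Fin N → ℝ) (i : Fin N) (y : ℝ) :
    (rodSolution g h i.succ 0).eval (-y) =
      (rodSolution g h i.castSucc 0).eval (-y) + h i * (rodSolution g h i.castSucc 1).eval (-y) := by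
  rw [rodSolution_succ]
  simp [transferMatrix, Matrix.mulVec, dotProduct, Fin.sum_univ_two]

theorem rodSolution_succ_eval_one {N : ℕ} (g h : Fin N → ℝ) (i : Fin N) (y : ℝ) :
    (rodSolution g h i.succ 1).eval (-y) =
      y * g i * (rodSolution g h i.castSucc 0).eval (-y) +
        (rodSolution g h i.castSucc 1).eval (-y) := by
  rw [rodSolution_succ]
  simp [transferMatrix, Matrix.mulVec, dotProduct, Fin.sum_univ_two, mul_comm y]

theorem rodSolution_eval_pos {N : ℕ} {g h : Fin N → ℝ} (hg : ∀ j, 0 < g j) (hh : ∀ j, 0 < h j)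
    {y : ℝ} (hy : 0 < y) (k : Fin (N + 1)) :
    0 ≤ (rodSolution g h k 0).eval (-y) ∧ 0 < (rodSolution g h k 1).eval (-y) := by
  induction k using Fin.induction with
  | zero => simp [rodSolution_zero]
  | succ i ih =>
    rw [rodSolution_succ_eval_zero, rodSolution_succ_eval_one]
    obtain ⟨h1, h2⟩ := ih
    have := hg i
    have := hh i
    constructor <;> positivity

theorem rodSolution_snoc {N : ℕ} (g h : Fin N → ℝ) (a b : ℝ) (k : Fin (N + 1)) :
    rodSolution (Fin.snoc g a : Fin (N + 1) → ℝ) (Fin.snoc h b : Fin (N + 1) → ℝ) k.castSucc =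
      rodSolution g h k := by
  induction k using Fin.induction with
  | zero => rfl
  | succ i ih =>
    rw [← Fin.succ_castSucc, rodSolution_succ, rodSolution_succ, ih, Fin.snoc_castSucc,
      Fin.snoc_castSucc]

/-- Existence for the inverse problem, with the rational identity evaluated at `z = -y < 0`. -/
theorem exists_rod (N : ℕ) : ∀ {K : ℕ}, K = N / 2 → ∀ (ζ b : Fin K → ℝ) (c : ℝ),
    (∀ j, 0 < ζ j) → StrictMono ζ → (∀ j, 0 < b j) → (Odd N → 0 < c) → (Even N → c = 0) →
    ∀ w : Fin N → ℝ, (∀ j, 0 < w j) →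
    ∃ g h : Fin N → ℝ, (∀ j, 0 < g j) ∧ (∀ j, 0 < h j) ∧ (∀ j, g j * h j = w j) ∧
      ∀ y, 0 < y → (rodSolution g h (Fin.last N) 0).eval (-y) =
        (c + ∑ j, b j / (ζ j + y)) * (rodSolution g h (Fin.last N) 1).eval (-y) := by
  induction N with
  | zero =>
    intro K hK ζ b c _ _ _ _ hc w _
    obtain rfl : K = 0 := hK
    have h0 : Fin.last 0 = 0 := rfl
    refine ⟨Fin.elim0, Fin.elim0, fun j => j.elim0, fun j => j.elim0, fun j => j.elim0,
      fun y _ => ?_⟩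
    rw [h0]
    simp [rodSolution_zero, hc]
  | succ N ih =>
    intro K hK ζ b c hζpos hζ hb hodd heven w hw
    -- The node of the outermost layer; singularity there forces h_N to be the value `t` of the Weyl
    -- function.
    set e := 1 / w (Fin.last N) with he
    have he0 : 0 < e := one_div_pos.mpr (hw _)
    set β : Fin K → ℝ := fun j => b j / (ζ j + e) with hβdef
    have hβ : ∀ j, 0 < β j := fun j => div_pos (hb j) (add_pos (hζpos j) he0)
    set t := c + ∑ j, b j / (ζ j + e) with ht
    have hS : 0 ≤ ∑ j, b j / (ζ j + e) := Finset.sum_nonneg fun j _ => (hβ j).le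
    have htpos : 0 < t := by
      rcases Nat.even_or_odd (N + 1) with hN | hN
      · have : Nonempty (Fin K) := ⟨⟨0, by obtain ⟨r, hr⟩ := hN; omega⟩⟩
        have : 0 < ∑ j, b j / (ζ j + e) :=
          Finset.sum_pos (fun j _ => hβ j) Finset.univ_nonempty
        rw [ht, heven hN]
        linarith
      · have := hodd hN
        linarith
    have hstep : ∃ (K' : ℕ) (d : ℝ) (ξ γ : Fin K' → ℝ), K' = N / 2 ∧ (Odd N → 0 < d) ∧
        (Even N → d = 0) ∧ (∀ l, 0 < ξ l) ∧ StrictMono ξ ∧ (∀ l, 0 < γ l) ∧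
        ∀ y, 0 < y → ∑ j, β j / (ζ j + y) = (d + ∑ l, γ l / (ξ l + y)) *
          (c + ∑ j, ζ j * β j / (ζ j + y)) := by
      rcases Nat.even_or_odd N with hN | hN
      · obtain ⟨ξ, γ, h1, h2, h3, h4⟩ := stieltjes_step_odd hζpos hζ hβ (hodd hN.add_one)
        refine ⟨K, 0, ξ, γ, ?_, fun h => absurd hN (Nat.not_even_iff_odd.mpr h), fun _ => rfl,
          h1, h2, h3, h4⟩
        obtain ⟨r, hr⟩ := hN
        omega
      · obtain ⟨n, rfl⟩ : ∃ n, K = n + 1 := ⟨K - 1, by obtain ⟨r, hr⟩ := hN; omega⟩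
        obtain ⟨d, ξ, γ, h0, h1, h2, h3, h4⟩ := stieltjes_step_even hζpos hζ hβ
        refine ⟨n, d, ξ, γ, ?_, fun _ => h0, fun h => absurd h (Nat.not_even_iff_odd.mpr hN),
          h1, h2, h3, ?_⟩
        · obtain ⟨r, hr⟩ := hN
          omega
        · rw [heven hN.add_one]
          exact h4
    obtain ⟨K', d, ξ, γ, hK', hd1, hd2, hξpos, hξ, hγ, hquot⟩ := hstep
    have het : 0 < e * t := mul_pos he0 htpos
    obtain ⟨g, h, hg, hh, hgh, heq⟩ := ih hK' ξ (fun l => e * t * γ l) (e * t * d) hξpos hξ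
      (fun l => mul_pos het (hγ l)) (fun hN => mul_pos het (hd1 hN))
      (fun hN => by rw [hd2 hN, mul_zero]) (fun j => w j.castSucc) (fun j => hw _)
    have hlast : 0 < w (Fin.last N) / t := div_pos (hw _) htpos
    refine ⟨Fin.snoc g (w (Fin.last N) / t), Fin.snoc h t, ?_, ?_, ?_, fun y hy => ?_⟩
    · intro j
      induction j using Fin.lastCases with
      | last => simpa using hlast
      | cast j => simpa using hg j
    · intro j
      induction j using Fin.lastCases with
      | last => simpa using htpos
      | cast j => simpa using hh j
    · intro j
      induction j using Fin.lastCases with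
      | last =>
        rw [Fin.snoc_last, Fin.snoc_last]
        field_simp
      | cast j => simpa using hgh j
    · rw [← Fin.succ_last, rodSolution_succ_eval_zero, rodSolution_succ_eval_one, rodSolution_snoc,
        Fin.snoc_last, Fin.snoc_last, heq y hy]
      have hw0 := (hw (Fin.last N)).ne'
      have hsum : e * t * d + ∑ l, e * t * γ l / (ξ l + y) =
          e * t * (d + ∑ l, γ l / (ξ l + y)) := by
        rw [mul_add (e * t), Finset.mul_sum]
        congr 1
        exact Finset.sum_congr rfl fun l _ => by ring
      rw [hsum]
      set v := d + ∑ l, γ l / (ξ l + y) with hv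
      have hq := hquot y hy
      set S := ∑ j, β j / (ζ j + y) with hSdef
      set F := c + ∑ j, ζ j * β j / (ζ j + y) with hF
      set V := c + ∑ j, b j / (ζ j + y) with hV
      -- Removing the layer sends V to (V - t)/(1 - y V/(e t)). Numerator and denominator both
      -- vanish at y = e; cancelling e - y leaves e t S/F.
      have h1 : V - t = (e - y) * S := by
        rw [hV, ht, hSdef, Finset.mul_sum, add_sub_add_left_eq_sub, ← Finset.sum_sub_distrib]
        refine Finset.sum_congr rfl fun j _ => ?_
        have := (add_pos (hζpos j) hy).ne'
        have := (add_pos (hζpos j) he0).ne'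
        simp only [hβdef]
        field_simp
        ring
      have h2 : y * V - e * t = (y - e) * F := by
        have : ∑ j, ζ j * β j / (ζ j + y) * (y - e) =
            ∑ j, y * (b j / (ζ j + y)) - ∑ j, e * (b j / (ζ j + e)) := by
          rw [← Finset.sum_sub_distrib]
          refine Finset.sum_congr rfl fun j _ => ?_
          have := (add_pos (hζpos j) hy).ne'
          have := (add_pos (hζpos j) he0).ne'
          simp only [hβdef]
          field_simp
          ring
        rw [hV, ht, hF]
        simp only [mul_add, ← Finset.mul_sum] at this ⊢
        rw [← Finset.sum_mul] at this
        linear_combination -this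
      have h3 : w (Fin.last N) / t = 1 / (e * t) := by
        rw [he]
        field_simp
      rw [h3]
      have key : e * t * v + t = V * (y * (1 / (e * t)) * (e * t * v) + 1) := by
        have : V * (y * (1 / (e * t)) * (e * t * v) + 1) = V * (y * v + 1) := by
          have := het.ne'
          field_simp
        rw [this]
        linear_combination (y - e) * hq - h1 - v * h2
      linear_combination (rodSolution g h (Fin.last N) 1).eval (-y) * key

/-! ### From rational functions to values, and the determinantal formulas. -/

/-- The rational identity `q / p = W` is equivalent to its evaluations on the negative axis. -/
theorem div_eq_weylFunction_iff {K : ℕ} (ζ b : Fin K → ℝ) (c : ℝ) (hζ : ∀ j, 0 < ζ j)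
    (q p : ℝ[X]) (hp : p ≠ 0) :
    algebraMap ℝ[X] (RatFunc ℝ) q / algebraMap ℝ[X] (RatFunc ℝ) p = weylFunction ζ b c ↔
      ∀ y, 0 < y → q.eval (-y) = (c + ∑ j, b j / (ζ j + y)) * p.eval (-y) := by
  set Z : ℝ[X] := ∏ i, (C (ζ i) - X) with hZ
  set Q : ℝ[X] := C c * Z + ∑ j, C (b j) * ∏ i ∈ Finset.univ.erase j, (C (ζ i) - X) with hQ
  have hne : ∀ i, C (ζ i) - X ≠ 0 := fun i h => by
    have := congrArg (fun f => coeff f 1) h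
    simp at this
  have hZ0 : Z ≠ 0 := Finset.prod_ne_zero_iff.mpr fun i _ => hne i
  have hinj := IsFractionRing.injective ℝ[X] (RatFunc ℝ)
  have hW : weylFunction ζ b c =
      algebraMap ℝ[X] (RatFunc ℝ) Q / algebraMap ℝ[X] (RatFunc ℝ) Z := by
    rw [eq_div_iff ((map_ne_zero_iff _ hinj).mpr hZ0), weylFunction, add_mul, Finset.sum_mul, hQ,
      map_add, map_mul, map_sum, RatFunc.algebraMap_C]
    congr 1
    refine Finset.sum_congr rfl fun j _ => ?_
    rw [hZ, ← Finset.mul_prod_erase _ _ (Finset.mem_univ j), map_mul, map_mul, map_sub,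
      RatFunc.algebraMap_C, RatFunc.algebraMap_C, RatFunc.algebraMap_X, ← mul_assoc,
      div_mul_cancel₀]
    rw [← RatFunc.algebraMap_C, ← RatFunc.algebraMap_X, ← map_sub]
    exact (map_ne_zero_iff _ hinj).mpr (hne j)
  have hZy : ∀ y, 0 < y → Z.eval (-y) ≠ 0 := fun y hy => by
    rw [hZ, eval_prod]
    refine Finset.prod_ne_zero_iff.mpr fun i _ => ?_
    simpa using (add_pos (hζ i) hy).ne'
  have hQy : ∀ y, 0 < y → Q.eval (-y) = (c + ∑ j, b j / (ζ j + y)) * Z.eval (-y) := by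
    intro y hy
    rw [hQ, eval_add, eval_mul, eval_C, eval_finsetSum, add_mul, Finset.sum_mul]
    congr 1
    refine Finset.sum_congr rfl fun j _ => ?_
    rw [hZ, ← Finset.mul_prod_erase _ _ (Finset.mem_univ j)]
    have := (add_pos (hζ j) hy).ne'
    simp only [eval_mul, eval_sub, eval_C, eval_X, sub_neg_eq_add]
    field_simp
  rw [hW, div_eq_div_iff ((map_ne_zero_iff _ hinj).mpr hp) ((map_ne_zero_iff _ hinj).mpr hZ0),
    ← map_mul, ← map_mul, hinj.eq_iff]
  constructor
  · intro h y hy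
    have h1 := congrArg (eval (-y)) h
    rw [eval_mul, eval_mul, hQy y hy] at h1
    exact mul_right_cancel₀ (hZy y hy) (by linear_combination h1)
  · intro h
    refine eq_of_infinite_eval_eq _ _ ((Set.Iio_infinite (0 : ℝ)).mono fun x hx => ?_)
    have hx' : 0 < -x := neg_pos.mpr hx
    have h1 := h (-x) hx'
    have h2 := hQy (-x) hx'
    rw [neg_neg] at h1 h2
    rw [Set.mem_ofPred_eq, eval_mul, eval_mul, h1, h2]
    ring

theorem shiftedStieltjes_spectralMeasure {K : ℕ} (ζ b : Fin K → ℝ) (c y : ℝ)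
    (hb : ∀ j, 0 < b j) :
    shiftedStieltjes (spectralMeasure ζ b) c y = c + ∑ j, b j / (ζ j + y) := by
  rw [shiftedStieltjes, spectralMeasure, integral_finsetSum_measure]
  · congr 1
    refine Finset.sum_congr rfl fun j _ => ?_
    rw [integral_smul_measure, integral_dirac, ENNReal.toReal_ofReal (hb j).le, smul_eq_mul,
      mul_one_div, add_comm]
  · intro j _
    exact (integrable_dirac (by simp)).smul_measure ENNReal.ofReal_ne_top

/-- Every solution of the inverse problem is given by the determinantal formulas. -/
theorem csvDet_formula {N : ℕ} {m n g h : Fin N → ℝ} {ν : Measure ℝ} {c : ℝ}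
    (hm : ∀ j, 0 < m j) (hn : ∀ j, 0 < n j) (hmn : Function.Injective fun j => m j * n j)
    (hg : ∀ j, 0 < g j) (hh : ∀ j, 0 < h j) (hgh : ∀ j, g j * h j = m j * n j)
    (hW : ∀ y, 0 < y → (rodSolution g h (Fin.last N) 0).eval (-y) =
      shiftedStieltjes ν c y * (rodSolution g h (Fin.last N) 1).eval (-y))
    (k : ℕ) (hk₁ : 1 ≤ k) (hk : k ≤ N) (hlt : N - k < N)
    (hpred : k - 1 ≤ N) :
    (g ⟨N - k, hlt⟩ =
      (csvDet m n ν c k hk (k / 2) 1 * csvDet m n ν c (k - 1) hpred ((k - 1) / 2) 1) /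
      (nodesProd m n k hk * csvDet m n ν c k hk ((k + 1) / 2) 0 *
        csvDet m n ν c (k - 1) hpred (k / 2) 0)) ∧
    h ⟨N - k, hlt⟩ =
      (nodesProd m n (k - 1) hpred * csvDet m n ν c k hk ((k + 1) / 2) 0 *
        csvDet m n ν c (k - 1) hpred (k / 2) 0) /
      (csvDet m n ν c k hk (k / 2) 1 * csvDet m n ν c (k - 1) hpred ((k - 1) / 2) 1) := by
  -- Layers are counted from the outermost inwards, so that `r j` carries the node e_{j+1}.
  -- Truncated subtraction for j ≥ N is harmless: the recurrences and injectivity are used only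
  -- below N.
  set r : ℕ → Fin N := fun j => ⟨N - 1 - j, by omega⟩ with hr
  set G : ℕ → ℝ := fun j => g (r j) with hG
  set H : ℕ → ℝ := fun j => h (r j) with hH
  set E : ℕ → ℝ := fun j => 1 / (m (r j) * n (r j)) with hE
  set s : ℕ → Fin (N + 1) := fun j => ⟨N - j, by omega⟩ with hs
  set q : ℕ → ℝ → ℝ := fun j y => (rodSolution g h (s j) 0).eval (-y) with hqdef
  set p : ℕ → ℝ → ℝ := fun j y => (rodSolution g h (s j) 1).eval (-y) with hpdef
  have hsucc : ∀ j < N, s j = (r j).succ := fun j hj => by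
    ext
    simp only [hs, hr, Fin.val_succ]
    omega
  have hcast : ∀ j < N, s (j + 1) = (r j).castSucc := fun j hj => by
    ext
    simp only [hs, hr, Fin.val_castSucc]
    omega
  have hEpos : ∀ j, 0 < E j := fun j => one_div_pos.mpr (mul_pos (hm _) (hn _))
  have hHpos : ∀ j, 0 < H j := fun j => hh _
  have hGHE : ∀ j, G j * H j * E j = 1 := fun j => by
    have := (mul_pos (hm (r j)) (hn (r j))).ne'
    simp only [hG, hH, hE, hgh]
    exact mul_one_div_cancel this
  have hinj : Set.InjOn E (Set.Iio N) := by
    intro i hi j hj hij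
    simp only [hE, one_div, inv_inj] at hij
    have h1 := congrArg Fin.val (hmn hij)
    simp only [hr] at h1
    simp only [Set.mem_Iio] at hi hj
    omega
  have hq : ∀ j < N, ∀ y, q j y = q (j + 1) y + H j * p (j + 1) y := fun j hj y => by
    simp only [hqdef, hpdef, hsucc j hj, hcast j hj, rodSolution_succ_eval_zero, hH]
  have hp : ∀ j < N, ∀ y, p j y = y * G j * q (j + 1) y + p (j + 1) y := fun j hj y => by
    simp only [hqdef, hpdef, hsucc j hj, hcast j hj, rodSolution_succ_eval_one, hG]
  have hpne : ∀ j, ∀ y, 0 < y → p j y ≠ 0 := fun j y hy =>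
    (rodSolution_eval_pos hg hh hy _).2.ne'
  have hqW : ∀ j, q 0 (E j) = shiftedStieltjes ν c (E j) * p 0 (E j) := fun j => hW _ (hEpos j)
  have hnodes : ∀ (i : ℕ) (hi : i ≤ N), nodes m n i hi = fun l : Fin i => E l := by
    intro i hi
    ext l
    have : (Fin.castLE hi l).rev = r l := by
      ext
      simp only [hr, Fin.val_rev, Fin.val_castLE]
      omega
    simp only [nodes, this, hE]
  have hnp : ∀ (i : ℕ) (hi : i ≤ N), nodesProd m n i hi = ∏ l ∈ Finset.range i, E l := by
    intro i hi
    rw [nodesProd, hnodes i hi, Fin.prod_univ_eq_prod_range]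
  have hL : ∀ (i : ℕ) (hi : i ≤ N), 0 < csvDet m n ν c i hi (i / 2) 1 ∧
      |(strippingLead G H i).1| * csvDet m n ν c i hi (i / 2) 1 =
        csvDet m n ν c i hi ((i + 1) / 2) 0 := by
    intro i hi
    simp only [csvDet, hnodes i hi]
    exact ⟨abs_pos.mpr (csvMatrix_det_ne_zero (fun j _ => hEpos j)
        (hinj.mono (Set.Iio_subset_Iio hi)) (fun j _ => hGHE j) (fun j hj => hq j (by omega))
        (fun j hj => hp j (by omega)) (fun j _ => hpne j) (fun j _ => hqW j)),
      abs_strippingLead_mul_abs_det (fun j _ => hEpos j)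
        (fun j _ => hGHE j) (fun j hj => hq j (by omega))
        (fun j hj => hp j (by omega)) (fun j _ => hpne j) (fun j _ => hqW j)⟩
  obtain ⟨k, rfl⟩ : ∃ k', k = k' + 1 := ⟨k - 1, by omega⟩
  have hk' : k ≤ N := by omega
  obtain ⟨hD, hDL⟩ := hL (k + 1) hk
  obtain ⟨hD', hDL'⟩ := hL k hk'
  have hrk : (⟨N - (k + 1), by omega⟩ : Fin N) = r k := by
    ext
    simp only [hr]
    omega
  have hgk : g ⟨N - (k + 1), by omega⟩ = G k := by rw [hrk]
  have hhk : h ⟨N - (k + 1), by omega⟩ = H k := by rw [hrk]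
  -- With L, M the absolute leads at k, the lead at k + 1 is H k * M, and L * M * ∏ E = 1 eliminates
  -- M. This gives H k, and G k follows from G H E = 1.
  have hM := congrArg abs (strippingLead_mul E G H k fun j _ => hGHE j)
  have hEp : 0 < ∏ i ∈ Finset.range k, E i := Finset.prod_pos fun i _ => hEpos i
  rw [abs_mul, abs_mul, abs_one, abs_of_pos hEp] at hM
  have hL1 : |(strippingLead G H (k + 1)).1| = H k * |(strippingLead G H k).2| := by
    simp [strippingLead, abs_mul, abs_of_pos (hHpos k)]
  rw [hL1] at hDL
  rw [hgk, hhk]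
  simp only [Nat.add_sub_cancel, hnp, Finset.prod_range_succ]
  rw [← hDL, ← hDL']
  set L := |(strippingLead G H k).1|
  set M := |(strippingLead G H k).2|
  have hhH := hHpos k
  have hEk := hEpos k
  have hLM : L ≠ 0 ∧ M ≠ 0 := by
    constructor <;> intro h <;> simp [h] at hM
  obtain ⟨hL0, hM0⟩ := hLM
  have hden : (∏ i ∈ Finset.range k, E i) * E k *
      (H k * M * csvDet m n ν c (k + 1) hk ((k + 1) / 2) 1) *
      (L * csvDet m n ν c k hk' (k / 2) 1) ≠ 0 := by
    simp only [ne_eq, mul_eq_zero, not_or]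
    exact ⟨⟨⟨hEp.ne', hEk.ne'⟩, ⟨hhH.ne', hM0⟩, hD.ne'⟩, hL0, hD'.ne'⟩
  refine ⟨(eq_div_iff hden).mpr ?_, (eq_div_iff (mul_pos hD hD').ne').mpr ?_⟩
  · linear_combination (csvDet m n ν c (k + 1) hk ((k + 1) / 2) 1 *
      csvDet m n ν c k hk' (k / 2) 1) * (G k * H k * E k * hM + hGHE k)
  · linear_combination (-(csvDet m n ν c (k + 1) hk ((k + 1) / 2) 1 *
      csvDet m n ν c k hk' (k / 2) 1)) * H k * hM

end

/-- In the formulas `k` runs through `1, …, N`, and `⟨N - k, _⟩ : Fin N` is the position of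
`k' = N + 1 - k`. All natural-number divisions by two are exact for the parity at hand. -/
theorem theorem4p8 (N : ℕ) (ζ b : Fin (N / 2) → ℝ) (c : ℝ) (m n : Fin N → ℝ)
    (hζ_pos : ∀ j, 0 < ζ j) (hζ_mono : StrictMono ζ) (hb : ∀ j, 0 < b j)
    (hc_odd : Odd N → 0 < c) (hc_even : Even N → c = 0)
    (hm : ∀ j, 0 < m j) (hn : ∀ j, 0 < n j)
    (hmn : Function.Injective fun j => m j * n j) :
    ∃ g h : Fin N → ℝ,
      SolvesInverseProblem (weylFunction ζ b c) m n g h ∧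
      (∀ g₁ h₁ : Fin N → ℝ,
        SolvesInverseProblem (weylFunction ζ b c) m n g₁ h₁ → g₁ = g ∧ h₁ = h) ∧
      ∀ (k : ℕ) (hk₁ : 1 ≤ k) (hk : k ≤ N),
        (Odd k →
          g ⟨N - k, by omega⟩ =
            (csvDet m n (spectralMeasure ζ b) c k hk ((k - 1) / 2) 1 *
              csvDet m n (spectralMeasure ζ b) c (k - 1) (by omega) ((k - 1) / 2) 1) /
              (nodesProd m n k hk *
              csvDet m n (spectralMeasure ζ b) c k hk ((k + 1) / 2) 0 *
              csvDet m n (spectralMeasure ζ b) c (k - 1) (by omega) ((k - 1) / 2) 0) ∧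
          h ⟨N - k, by omega⟩ =
            (nodesProd m n (k - 1) (by omega) *
              csvDet m n (spectralMeasure ζ b) c k hk ((k + 1) / 2) 0 *
              csvDet m n (spectralMeasure ζ b) c (k - 1) (by omega) ((k - 1) / 2) 0) /
              (csvDet m n (spectralMeasure ζ b) c k hk ((k - 1) / 2) 1 *
              csvDet m n (spectralMeasure ζ b) c (k - 1) (by omega) ((k - 1) / 2) 1)) ∧
        (Even k →
          g ⟨N - k, by omega⟩ =
            (csvDet m n (spectralMeasure ζ b) c k hk (k / 2) 1 *
              csvDet m n (spectralMeasure ζ b) c (k - 1) (by omega) (k / 2 - 1) 1) /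
              (nodesProd m n k hk *
              csvDet m n (spectralMeasure ζ b) c k hk (k / 2) 0 *
              csvDet m n (spectralMeasure ζ b) c (k - 1) (by omega) (k / 2) 0) ∧
          h ⟨N - k, by omega⟩ =
            (nodesProd m n (k - 1) (by omega) *
              csvDet m n (spectralMeasure ζ b) c k hk (k / 2) 0 *
              csvDet m n (spectralMeasure ζ b) c (k - 1) (by omega) (k / 2) 0) /
              (csvDet m n (spectralMeasure ζ b) c k hk (k / 2) 1 *
              csvDet m n (spectralMeasure ζ b) c (k - 1) (by omega) (k / 2 - 1) 1)) := by
  have hW : ∀ y, shiftedStieltjes (spectralMeasure ζ b) c y = c + ∑ j, b j / (ζ j + y) :=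
    fun y => shiftedStieltjes_spectralMeasure ζ b c y hb
  have hpne : ∀ g h : Fin N → ℝ, (∀ j, 0 < g j) → (∀ j, 0 < h j) →
      rodSolution g h (Fin.last N) 1 ≠ 0 := fun g h hg hh h0 => by
    have := (rodSolution_eval_pos hg hh one_pos (Fin.last N)).2
    simp [h0] at this
  have heval : ∀ g h : Fin N → ℝ, SolvesInverseProblem (weylFunction ζ b c) m n g h →
      ∀ y, 0 < y → (rodSolution g h (Fin.last N) 0).eval (-y) =
        shiftedStieltjes (spectralMeasure ζ b) c y * (rodSolution g h (Fin.last N) 1).eval (-y) := by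
    intro g h ⟨hg, hh, _, hqp⟩ y hy
    rw [hW]
    exact (div_eq_weylFunction_iff ζ b c hζ_pos _ _ (hpne g h hg hh)).mp hqp y hy
  have hformula := fun (g h : Fin N → ℝ)
      (hs : SolvesInverseProblem (weylFunction ζ b c) m n g h) =>
    csvDet_formula hm hn hmn hs.1 hs.2.1 hs.2.2.1 (heval g h hs)
  obtain ⟨g, h, hg, hh, hgh, hqp⟩ := exists_rod N rfl ζ b c hζ_pos hζ_mono hb hc_odd hc_even
    (fun j => m j * n j) fun j => mul_pos (hm j) (hn j)
  have hs : SolvesInverseProblem (weylFunction ζ b c) m n g h :=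
    ⟨hg, hh, hgh, (div_eq_weylFunction_iff ζ b c hζ_pos _ _ (hpne g h hg hh)).mpr hqp⟩
  refine ⟨g, h, hs, fun g₁ h₁ hs₁ => ⟨?_, ?_⟩, fun k hk₁ hk => ⟨fun hodd => ?_, fun heven => ?_⟩⟩
  -- Taking k = N - j puts the formula at position j; its right side depends on the data only.
  · ext j
    have hj : (⟨N - (N - j), by omega⟩ : Fin N) = j := by
      ext
      simp only
      omega
    have h1 := (hformula g₁ h₁ hs₁ (N - j) (by omega) (by omega) (by omega) (by omega)).1
    have h2 := (hformula g h hs (N - j) (by omega) (by omega) (by omega) (by omega)).1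
    rw [hj] at h1 h2
    rw [h1, h2]
  · ext j
    have hj : (⟨N - (N - j), by omega⟩ : Fin N) = j := by
      ext
      simp only
      omega
    have h1 := (hformula g₁ h₁ hs₁ (N - j) (by omega) (by omega) (by omega) (by omega)).2
    have h2 := (hformula g h hs (N - j) (by omega) (by omega) (by omega) (by omega)).2
    rw [hj] at h1 h2
    rw [h1, h2]
  · have e : (k - 1) / 2 = k / 2 := by
      obtain ⟨r, rfl⟩ := hodd
      omega
    have hf := hformula g h hs k hk₁ hk (by omega) (by omega)
    rw [e] at hf ⊢
    exact hf
  · have e₁ : (k + 1) / 2 = k / 2 := by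
      obtain ⟨r, rfl⟩ := heven
      omega
    have e₂ : (k - 1) / 2 = k / 2 - 1 := by
      obtain ⟨r, rfl⟩ := heven
      omega
    have hf := hformula g h hs k hk₁ hk (by omega) (by omega)
    rw [e₁, e₂] at hf
    exact hf
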